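/- Let $n\ge 0$ and let $S_n$ be the set of permutations $\sigma=\sigma_1\cdots\sigma_n$ of $\{1,\dots,n\}$. Label the cells of the $n\times n$ grid by (row, column) as in a matrix. Let $B(n)=\{(i,j):1\le i<j\le n\}$, a board with top-justified columns of heights $c_1,\dots,c_n$, where $c_j=j-1$, and let $B(n)^c$ be the complementary board, with top-justified columns of heights $n-c_n,\dots,n-c_1$; thus $B(n)^c=\{(i,j):1\le i\le j\le n\}$. For $\sigma\in S_n$ let $C(\sigma)^T$ be the placement of $n$ rooks on the cells $(\sigma_i,i)$, $1\le i\le n$ (the transpose of the graph $\{(i,\sigma_i)\}$ of $\sigma$). For a placement $C$ of $n$ non-attacking rooks on the grid and a board $B$, define Dworkin's statistic $\xi(C,B)$ as follows. Call a cell empty if it neither contains a rook nor lies to the right of a rook in the same row. For each rook on $B$, put a circle in every empty cell of $B$ below it in its column; for each rook off $B$, put a circle in every empty cell below it in its column and in every empty cell of $B$ above it in its column. Then $\xi(C,B)$ is the number of circles. Let $\mathrm{exc}(\sigma)=\#\{i:\sigma_i>i\}$, $\mathrm{des}(\sigma)=\#\{1\le i<n:\sigma_i>\sigma_{i+1}\}$,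 $\mathrm{maj}(\sigma)=\sum_{1\le i<n,\ \sigma_i>\sigma_{i+1}}i$, and let Denert's statistic be $$\mathrm{den}(\sigma)=\#\{i<j:\sigma_i\le j<\sigma_j\}+\#\{i<j:\sigma_i>\sigma_j>j\}+\#\{i<j: j\ge\sigma_i>\sigma_j\},$$ where $1\le i,j\le n$. Then for every $\sigma\in S_n$ $$\xi\bigl(C(\sigma)^T,B(n)^c\bigr)=n\cdot\mathrm{exc}(\sigma)-\mathrm{den}(\sigma),$$ and $(\mathrm{exc},\mathrm{den})$ is jointly distributed with $(\mathrm{des},\mathrm{maj})$ on $S_n$, that is, as polynomials in $p$ and $q$, $$\sum_{\sigma\in S_n}p^{\mathrm{exc}(\sigma)}q^{\mathrm{den}(\sigma)}=\sum_{\sigma\in S_n}p^{\mathrm{des}(\sigma)}q^{\mathrm{maj}(\sigma)}.$$ -/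

import Mathlib

/-! Rows, columns, positions and letters `1, …, n` are represented by `Fin n` (shifted down by
one); cells of the `n × n` grid are pairs `(row, column)`, rows being numbered from the top. -/

namespace RookStat

/-- A board, or a placement of rooks: a set of cells of the `n × n` grid. -/
abbrev Cells (n : ℕ) := Finset (Fin n × Fin n)

/-- The height of column `j` of a board. -/
def colHeight {n : ℕ} (B : Cells n) (j : Fin n) : ℕ :=
  (Finset.univ.filter fun i : Fin n => (i, j) ∈ B).card

/-- The complementary board of a Ferrers board with column heights `c_1, …, c_n`: the Ferrers
board (columns top-justified) with column heights `n - c_n, …, n - c_1`. -/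
def complBoard {n : ℕ} (B : Cells n) : Cells n :=
  Finset.univ.filter fun x => (x.1 : ℕ) < n - colHeight B (Fin.rev x.2)

/-- The triangular board `B(n)`, made of the cells `(i, j)` with `i < j`. -/
def triBoard (n : ℕ) : Cells n :=
  Finset.univ.filter fun x => x.1 < x.2

/-- The graph of a permutation: a rook on `(i, j)` if and only if `σ i = j`. -/
def graph {n : ℕ} (σ : Equiv.Perm (Fin n)) : Cells n :=
  Finset.univ.filter fun x => σ x.1 = x.2

/-- The transpose of a placement. -/
def transpose {n : ℕ} (C : Cells n) : Cells n :=
  Finset.univ.filter fun x => (x.2, x.1) ∈ C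

/-- A cell is occupied if it contains a rook (marked by a bullet) or lies to the right of a rook
in its row (marked by an `x`). -/
def Occupied {n : ℕ} (C : Cells n) (x : Fin n × Fin n) : Prop :=
  x ∈ C ∨ ∃ j, j < x.2 ∧ (x.1, j) ∈ C

/-- The cell `x` receives a circle: it is empty, and in its column there is a rook in some row
`r` such that
* the rook is on `B`, and `x` is below it and on `B`; or
* the rook is off `B`, and `x` is below it; or
* the rook is off `B`, and `x` is above it and on `B`. -/
def Circled {n : ℕ} (C B : Cells n) (x : Fin n × Fin n) : Prop :=
  ¬ Occupied C x ∧ ∃ r, (r, x.2) ∈ C ∧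
    (((r, x.2) ∈ B ∧ r < x.1 ∧ x ∈ B) ∨
     ((r, x.2) ∉ B ∧ r < x.1) ∨
     ((r, x.2) ∉ B ∧ x.1 < r ∧ x ∈ B))

instance {n : ℕ} (C : Cells n) : DecidablePred (Occupied C) := fun x =>
  inferInstanceAs (Decidable (x ∈ C ∨ ∃ j, j < x.2 ∧ (x.1, j) ∈ C))

instance {n : ℕ} (C B : Cells n) : DecidablePred (Circled C B) := fun x =>
  inferInstanceAs (Decidable (¬ Occupied C x ∧ ∃ r, (r, x.2) ∈ C ∧
    (((r, x.2) ∈ B ∧ r < x.1 ∧ x ∈ B) ∨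
     ((r, x.2) ∉ B ∧ r < x.1) ∨
     ((r, x.2) ∉ B ∧ x.1 < r ∧ x ∈ B))))

/-- Dworkin's statistic `ξ(C, B)`: the number of circles. -/
def xi {n : ℕ} (C B : Cells n) : ℕ :=
  (Finset.univ.filter (Circled C B)).card

/-- The number of excedences. -/
def exc {n : ℕ} (σ : Equiv.Perm (Fin n)) : ℕ :=
  (Finset.univ.filter fun i : Fin n => i < σ i).card

/-- The positions `i` (zero-based) with `σ i > σ (i + 1)`. -/
def descents {n : ℕ} (σ : Equiv.Perm (Fin n)) : Finset (Fin n) :=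
  Finset.univ.filter fun i : Fin n => ∃ h : (i : ℕ) + 1 < n, σ ⟨(i : ℕ) + 1, h⟩ < σ i

/-- The number of descents. -/
def des {n : ℕ} (σ : Equiv.Perm (Fin n)) : ℕ := (descents σ).card

/-- The major index: the sum of the (one-based) descent positions. -/
def maj {n : ℕ} (σ : Equiv.Perm (Fin n)) : ℕ := ∑ i ∈ descents σ, ((i : ℕ) + 1)

/-- Denert's statistic. All comparisons are unaffected by the common shift of positions and
letters. -/
def den {n : ℕ} (σ : Equiv.Perm (Fin n)) : ℕ :=
  (Finset.univ.filter fun x : Fin n × Fin n => x.1 < x.2 ∧ σ x.1 ≤ x.2 ∧ x.2 < σ x.2).card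
  + (Finset.univ.filter fun x : Fin n × Fin n => x.1 < x.2 ∧ σ x.1 > σ x.2 ∧ σ x.2 > x.2).card
  + (Finset.univ.filter fun x : Fin n × Fin n => x.1 < x.2 ∧ x.2 ≥ σ x.1 ∧ σ x.1 > σ x.2).card

/-- The bivariate generating polynomial `∑_σ p ^ stat1(σ) q ^ stat2(σ)` in `ℤ[p, q]`. -/
noncomputable def jointGen {n : ℕ} (stat1 stat2 : Equiv.Perm (Fin n) → ℕ) :
    MvPolynomial (Fin 2) ℤ :=
  ∑ σ : Equiv.Perm (Fin n), MvPolynomial.X 0 ^ stat1 σ * MvPolynomial.X 1 ^ stat2 σ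

/-- The pair `(stat1, stat2)` is jointly distributed with `(stat3, stat4)` on `S_n`. -/
def JointlyDistributed {n : ℕ} (stat1 stat2 stat3 stat4 : Equiv.Perm (Fin n) → ℕ) : Prop :=
  jointGen stat1 stat2 = jointGen stat3 stat4

end RookStat

namespace RookStat

/-! For fixed `j`, consider the letters in the cyclic interval from `σ j` (excluded) to `j`
(included). Those at positions after `j` give the circles in column `j` (`circled_iff`). Those at
positions before `j` give the pairs counted by `den` (`den_eq_sum`), its three terms being the
shapes of the interval. The letter at `j` itself is the excluded endpoint, so `xi + den` is the sum
of the interval sizes `j - σ j + n * [j < σ j]`, and the differences cancel over `j`.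

For equidistribution, both pairs obey one recursion. A permutation of `n` letters and `s` in `0, …,
n` yield a permutation of `n + 1` letters for which the second statistic grows by `s`, and the first
by one exactly when it was less than `s` (`exists_equiv_of_insertion`). For `(des, maj)`, insert the
largest letter. For `(exc, den)`, write `den` as the sum of excedance positions plus inversions
within the excedances and within the other letters (`den_eq_sum_exc_add_inv`). Then `insertExc`
inserts a letter while preserving old excedances and both kinds of old inversions. The same function
`increment` governs the two insertions, with `D` the descent positions or the excedance letters. -/

/-! ### Circles, Denert pairs and cyclic intervals. -/

/-- `v` lies in the cyclic interval from `a` (excluded) up to `b` (included). -/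
def CycMem {n : ℕ} (a b v : Fin n) : Prop :=
  (a ≤ b ∧ a < v ∧ v ≤ b) ∨ (b < a ∧ (a < v ∨ v ≤ b))

instance {n : ℕ} (a b v : Fin n) : Decidable (CycMem a b v) :=
  inferInstanceAs (Decidable ((a ≤ b ∧ a < v ∧ v ≤ b) ∨ (b < a ∧ (a < v ∨ v ≤ b))))

lemma card_cycMem {n : ℕ} (a b : Fin n) :
    ((Finset.univ.filter fun v => CycMem a b v).card : ℤ)
      = (b : ℤ) - (a : ℤ) + if b < a then (n : ℤ) else 0 := by
  by_cases h : b < a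
  · have : (Finset.univ.filter fun v => CycMem a b v) = Finset.Ioi a ∪ Finset.Iic b := by
      ext v
      simp [CycMem, h, not_le.2 h]
    rw [this, Finset.card_union_of_disjoint, Fin.card_Ioi, Fin.card_Iic, if_pos h]
    · have := a.isLt
      lia
    · rw [Finset.disjoint_left]
      intro v h1 h2
      simp only [Finset.mem_Ioi, Finset.mem_Iic] at h1 h2
      exact absurd (h1.trans_le h2) (not_lt.2 h.le)
  · have h' := not_lt.1 h
    have : (Finset.univ.filter fun v => CycMem a b v) = Finset.Ioc a b := by
      ext v
      simp [CycMem, h, h']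
    rw [this, Fin.card_Ioc, if_neg h]
    have : (a : ℕ) ≤ b := h'
    lia

lemma den_eq_sum {n : ℕ} (σ : Equiv.Perm (Fin n)) :
    den σ = ∑ j, ∑ i, if i < j ∧ CycMem (σ j) j (σ i) then 1 else 0 := by
  rw [Finset.sum_comm]
  simp only [den, Finset.card_filter, Fintype.sum_prod_type, ← Finset.sum_add_distrib]
  refine Finset.sum_congr rfl fun i _ => Finset.sum_congr rfl fun j _ => ?_
  unfold CycMem
  split_ifs <;> first | rfl | (exfalso; lia)

lemma mem_complBoard_triBoard {n : ℕ} (i j : Fin n) :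
    (i, j) ∈ complBoard (triBoard n) ↔ i ≤ j := by
  have : colHeight (triBoard n) (Fin.rev j) = n - (j + 1) := by
    have h : (Finset.univ.filter fun i : Fin n => (i, Fin.rev j) ∈ triBoard n)
        = Finset.Iio (Fin.rev j) := by
      ext i
      simp [triBoard]
    rw [colHeight, h, Fin.card_Iio, Fin.val_rev]
  simp only [complBoard, Finset.mem_filter, Finset.mem_univ, true_and, this]
  have := j.isLt
  rw [Fin.le_def]
  lia

lemma mem_transpose_graph {n : ℕ} (σ : Equiv.Perm (Fin n)) (i j : Fin n) :
    (i, j) ∈ transpose (graph σ) ↔ σ j = i := by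
  simp [transpose, graph]

/-- The rook of row `σ i` is in column `i`, so the cell is empty exactly when `j < i`. The rook of
column `j` is on the board iff `σ j ≤ j`; the two cases give an ordinary and a wrapping interval. -/
lemma circled_iff {n : ℕ} (σ : Equiv.Perm (Fin n)) (i j : Fin n) :
    Circled (transpose (graph σ)) (complBoard (triBoard n)) (σ i, j)
      ↔ j < i ∧ CycMem (σ j) j (σ i) := by
  have hocc : Occupied (transpose (graph σ)) (σ i, j) ↔ i ≤ j := by
    simp only [Occupied, mem_transpose_graph, EmbeddingLike.apply_eq_iff_eq, exists_eq_right]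
    rw [le_iff_eq_or_lt, eq_comm]
  simp only [Circled, hocc, mem_transpose_graph, mem_complBoard_triBoard, exists_eq_left', CycMem,
    not_le]
  constructor
  · rintro ⟨h, h'⟩
    refine ⟨h, ?_⟩
    lia
  · rintro ⟨h, h'⟩
    refine ⟨h, ?_⟩
    lia

lemma xi_eq_sum {n : ℕ} (σ : Equiv.Perm (Fin n)) :
    xi (transpose (graph σ)) (complBoard (triBoard n))
      = ∑ j, ∑ i, if j < i ∧ CycMem (σ j) j (σ i) then 1 else 0 := by
  rw [xi, Finset.card_filter, Fintype.sum_prod_type, Finset.sum_comm]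
  refine Finset.sum_congr rfl fun j _ => ?_
  rw [← Equiv.sum_comp σ]
  simp only [circled_iff]

lemma xi_add_den {n : ℕ} (σ : Equiv.Perm (Fin n)) :
    (xi (transpose (graph σ)) (complBoard (triBoard n)) : ℤ) + den σ = n * exc σ := by
  have h : xi (transpose (graph σ)) (complBoard (triBoard n)) + den σ
      = ∑ j, (Finset.univ.filter fun v => CycMem (σ j) j v).card := by
    rw [xi_eq_sum, den_eq_sum, ← Finset.sum_add_distrib]
    refine Finset.sum_congr rfl fun j _ => ?_
    rw [Finset.card_filter, ← Equiv.sum_comp σ (fun v => if CycMem (σ j) j v then 1 else 0),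
      ← Finset.sum_add_distrib]
    refine Finset.sum_congr rfl fun i _ => ?_
    rcases lt_trichotomy i j with h | rfl | h
    · simp [h, h.not_gt]
    · have : ¬ CycMem (σ i) i (σ i) := by
        unfold CycMem
        lia
      simp [this]
    · simp [h, h.not_gt]
  have h2 : ∑ j : Fin n, ((j : ℤ) - (σ j : ℤ)) = 0 := by
    rw [Finset.sum_sub_distrib, Equiv.sum_comp σ (fun j : Fin n => (j : ℤ)), sub_self]
  rw [← Nat.cast_add, h, Nat.cast_sum]
  simp only [card_cycMem]
  rw [Finset.sum_add_distrib, h2, exc, Finset.card_filter, Nat.cast_sum, Finset.mul_sum, zero_add]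
  simp

/-! ### The insertion recursion common to both pairs. -/

/-- The increment of the Mahonian statistic when a new letter is inserted at the position `x`. -/
def increment (D : Finset ℕ) (n x : ℕ) : ℕ :=
  (D.filter fun y => x ≤ y).card + if x ∈ D ∨ x = n then 0 else x + 1

lemma card_filter_le_add {D : Finset ℕ} (a b : ℕ) :
    (D.filter fun y => a ≤ y).card ≤ (D.filter fun y => b ≤ y).card + (b - a) := by
  have : (D.filter fun y => a ≤ y) ⊆ (D.filter fun y => b ≤ y) ∪ Finset.Ico a b := by
    intro y
    simp only [Finset.mem_union, Finset.mem_filter, Finset.mem_Ico]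
    lia
  exact (Finset.card_le_card this).trans
    ((Finset.card_union_le _ _).trans (by rw [Nat.card_Ico]))

lemma filter_le_eq_of_notMem {D : Finset ℕ} {x : ℕ} (hx : x ∉ D) :
    (D.filter fun y => x ≤ y) = D.filter fun y => x + 1 ≤ y := by
  refine Finset.filter_congr fun y hy => ?_
  have : y ≠ x := fun h => hx (h ▸ hy)
  lia

lemma card_filter_le_eq_zero {D : Finset ℕ} {n : ℕ} (hD : D ⊆ Finset.range n) :
    (D.filter fun y => n ≤ y).card = 0 := by
  rw [Finset.card_eq_zero, Finset.filter_eq_empty_iff]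
  intro y hy
  have := Finset.mem_range.1 (hD hy)
  lia

lemma increment_le {D : Finset ℕ} {n x : ℕ} (hD : D ⊆ Finset.range n) (hx : x ≤ n) :
    increment D n x ≤ n := by
  have h0 := card_filter_le_eq_zero hD
  unfold increment
  split_ifs with h
  · have := card_filter_le_add (D := D) x n
    lia
  · push Not at h
    have h1 : x < n := lt_of_le_of_ne hx h.2
    rw [filter_le_eq_of_notMem h.1]
    have := card_filter_le_add (D := D) (x + 1) n
    lia

/-- At most `x` elements of `D` lie below `x`, so the extra `x + 1` always exceeds their number.
Thus the size of the increment alone tells whether the Eulerian statistic grows. -/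
lemma card_lt_increment_iff {D : Finset ℕ} {n x : ℕ} :
    D.card < increment D n x ↔ ¬ (x ∈ D ∨ x = n) := by
  unfold increment
  split_ifs with h
  · simpa [h] using Finset.card_le_card (Finset.filter_subset _ _)
  · have := card_filter_le_add (D := D) 0 x
    simp only [Nat.zero_le, Finset.filter_true] at this
    simp only [h, not_false_eq_true, iff_true]
    lia

lemma card_filter_lt_of_lt {D : Finset ℕ} {a b : ℕ} (hab : a < b) (ha : a ∈ D) :
    (D.filter fun y => b ≤ y).card < (D.filter fun y => a ≤ y).card := by
  refine Finset.card_lt_card (Finset.ssubset_iff_of_subset ?_ |>.2 ⟨a, ?_, ?_⟩)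
  · intro y
    simp only [Finset.mem_filter]
    lia
  · simp [ha]
  · simp [hab]

/-- The increment strictly decreases along `D ∪ {n}` and strictly increases along the other
positions; `card_lt_increment_iff` separates the two ranges. -/
lemma increment_ne_of_lt {D : Finset ℕ} {n a b : ℕ} (hb : b ≤ n) (hab : a < b) :
    increment D n a ≠ increment D n b := by
  intro h
  have h1 : (a ∈ D ∨ a = n) ↔ (b ∈ D ∨ b = n) := by
    rw [← not_iff_not, ← card_lt_increment_iff, ← card_lt_increment_iff, h]
  unfold increment at h
  by_cases ha : a ∈ D ∨ a = n
  · rw [if_pos ha, if_pos (h1.1 ha)] at h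
    have := card_filter_lt_of_lt hab (ha.resolve_right (by lia))
    lia
  · rw [if_neg ha, if_neg (mt h1.2 ha), filter_le_eq_of_notMem (D := D) (x := a) (by tauto)] at h
    have := card_filter_le_add (D := D) (a + 1) b
    lia

/-- The increments at the positions `0, …, n`, as a permutation. -/
noncomputable def incrementEquiv {n : ℕ} (D : Finset ℕ) (hD : D ⊆ Finset.range n) :
    Fin (n + 1) ≃ Fin (n + 1) :=
  Equiv.ofBijective
    (fun x => ⟨increment D n x, Nat.lt_succ_of_le (increment_le hD (Nat.le_of_lt_succ x.isLt))⟩)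
    (Finite.injective_iff_bijective.1 fun a b h => by
      have h := congrArg Fin.val h
      rcases lt_trichotomy a b with hab | hab | hab
      · exact absurd h (increment_ne_of_lt (Nat.le_of_lt_succ b.isLt) hab)
      · exact hab
      · exact absurd h.symm (increment_ne_of_lt (Nat.le_of_lt_succ a.isLt) hab))

/-- An insertion procedure that turns a permutation of `n` letters and a position into a
permutation of `n + 1` letters, for an Eulerian statistic `e` and a Mahonian statistic `m`. -/
lemma exists_equiv_of_insertion {n : ℕ} {e m : Equiv.Perm (Fin n) → ℕ}
    {e' m' : Equiv.Perm (Fin (n + 1)) → ℕ} (D : Equiv.Perm (Fin n) → Finset ℕ)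
    (F : Equiv.Perm (Fin n) × Fin (n + 1) → Equiv.Perm (Fin (n + 1)))
    (hF : Function.Injective F) (hD : ∀ σ, D σ ⊆ Finset.range n) (hcard : ∀ σ, (D σ).card = e σ)
    (he : ∀ σ x, e' (F (σ, x)) = e σ + if (x : ℕ) ∈ D σ ∨ (x : ℕ) = n then 0 else 1)
    (hm : ∀ σ x, m' (F (σ, x)) = m σ + increment (D σ) n x) :
    ∃ Φ : Equiv.Perm (Fin n) × Fin (n + 1) ≃ Equiv.Perm (Fin (n + 1)), ∀ σ s,
      e' (Φ (σ, s)) = e σ + (if e σ < s then 1 else 0) ∧ m' (Φ (σ, s)) = m σ + s := by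
  have hb : Function.Bijective F := by
    rw [Fintype.bijective_iff_injective_and_card]
    refine ⟨hF, ?_⟩
    simp [Fintype.card_perm, Nat.factorial_succ, mul_comm]
  refine ⟨(Equiv.prodShear (Equiv.refl _) fun σ => (incrementEquiv (D σ) (hD σ)).symm).trans
    (Equiv.ofBijective F hb), fun σ s => ?_⟩
  -- The second coordinate of `Φ` is the increment rather than the position `x` that produces it.
  obtain ⟨x, rfl⟩ := (incrementEquiv (D σ) (hD σ)).surjective s
  have hx : ((incrementEquiv (D σ) (hD σ) x : Fin (n + 1)) : ℕ) = increment (D σ) n x := rfl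
  have hc := card_lt_increment_iff (D := D σ) (n := n) (x := x)
  rw [hcard] at hc
  simp only [Equiv.trans_apply, Equiv.prodShear_apply, Equiv.refl_apply, Equiv.symm_apply_apply,
    Equiv.ofBijective_apply, he, hm, hx, hc, and_true]
  split_ifs <;> simp_all

/-! ### Inserting the largest letter: descents and major index. -/

lemma insertNth_injective_of_ne {n : ℕ} {α : Type*} {f : Fin n → α} {a : α} {x : Fin (n + 1)}
    (hf : Function.Injective f) (ha : ∀ i, f i ≠ a) :
    Function.Injective (Fin.insertNth x a f : Fin (n + 1) → α) := by
  intro i j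
  induction i using Fin.succAboveCases x <;> induction j using Fin.succAboveCases x
  · simp
  · simpa using fun h => (ha _ h.symm).elim
  · simpa using fun h => (ha _ h).elim
  · simpa using fun h => hf h

/-- The word obtained from `f` by inserting the letter `a` at the position `x`, as a permutation. -/
noncomputable def insertPerm {n : ℕ} (x : Fin (n + 1)) (a : Fin (n + 1)) (f : Fin n → Fin (n + 1))
    (hf : Function.Injective f) (ha : ∀ i, f i ≠ a) : Equiv.Perm (Fin (n + 1)) :=
  Equiv.ofBijective (Fin.insertNth (α := fun _ => Fin (n + 1)) x a f)
    (Finite.injective_iff_bijective.1 (insertNth_injective_of_ne hf ha))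

@[simp] lemma insertPerm_apply_same {n : ℕ} (x a : Fin (n + 1)) (f : Fin n → Fin (n + 1)) (hf ha) :
    insertPerm x a f hf ha x = a := by
  simp [insertPerm]

@[simp] lemma insertPerm_apply_succAbove {n : ℕ} (x a : Fin (n + 1)) (f : Fin n → Fin (n + 1))
    (hf ha) (i : Fin n) : insertPerm x a f hf ha (x.succAbove i) = f i := by
  simp [insertPerm]

/-- The insertion of a largest letter. -/
noncomputable def insertLast {n : ℕ} (σ : Equiv.Perm (Fin n)) (x : Fin (n + 1)) :
    Equiv.Perm (Fin (n + 1)) :=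
  insertPerm x (Fin.last n) (fun i => (σ i).castSucc)
    ((Fin.castSucc_injective n).comp σ.injective) (fun i => Fin.castSucc_ne_last (σ i))

lemma insertLast_injective {n : ℕ} :
    Function.Injective fun y : Equiv.Perm (Fin n) × Fin (n + 1) => insertLast y.1 y.2 := by
  rintro ⟨σ, x⟩ ⟨τ, y⟩ h
  simp only at h
  have hxy : x = y := by
    apply (insertLast τ y).injective
    nth_rewrite 1 [← h]
    simp [insertLast]
  subst hxy
  refine Prod.ext (Equiv.ext fun i => ?_) rfl
  have := Equiv.congr_fun h (x.succAbove i)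
  simpa [insertLast] using this

/-- The positions `y` such that `y - 1` is a descent. -/
def descentTops {n : ℕ} (σ : Equiv.Perm (Fin n)) : Finset ℕ :=
  (descents σ).image fun i : Fin n => (i : ℕ) + 1

lemma succ_mem_descentTops {n : ℕ} {σ : Equiv.Perm (Fin n)} {y : ℕ} :
    y + 1 ∈ descentTops σ ↔ ∃ h : y + 1 < n, σ ⟨y + 1, h⟩ < σ ⟨y, by lia⟩ := by
  simp only [descentTops, descents, Finset.mem_image, Finset.mem_filter, Finset.mem_univ, true_and]
  constructor
  · rintro ⟨i, ⟨h, h'⟩, hi⟩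
    obtain rfl : (i : ℕ) = y := by lia
    exact ⟨h, h'⟩
  · rintro ⟨h, h'⟩
    exact ⟨⟨y, by lia⟩, ⟨h, h'⟩, rfl⟩

lemma zero_notMem_descentTops {n : ℕ} (σ : Equiv.Perm (Fin n)) : 0 ∉ descentTops σ := by
  simp [descentTops]

lemma descentTops_subset {n : ℕ} (σ : Equiv.Perm (Fin n)) :
    descentTops σ ⊆ Finset.range n := by
  intro y hy
  cases y with
  | zero => exact absurd hy (zero_notMem_descentTops σ)
  | succ y => exact Finset.mem_range.2 (succ_mem_descentTops.1 hy).1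

lemma card_descentTops {n : ℕ} (σ : Equiv.Perm (Fin n)) : (descentTops σ).card = des σ :=
  Finset.card_image_of_injective _ fun _ _ h => Fin.ext (Nat.succ_injective h)

lemma sum_descentTops {n : ℕ} (σ : Equiv.Perm (Fin n)) : ∑ y ∈ descentTops σ, y = maj σ :=
  Finset.sum_image fun _ _ _ _ h => Fin.ext (Nat.succ_injective h)

lemma insertLast_apply_of_lt {n : ℕ} (σ : Equiv.Perm (Fin n)) {x : Fin (n + 1)} {y : ℕ}
    (h : y < x) : insertLast σ x ⟨y, by lia⟩ = (σ ⟨y, by lia⟩).castSucc := by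
  have : (⟨y, by lia⟩ : Fin (n + 1)) = x.succAbove ⟨y, by lia⟩ := by
    rw [Fin.succAbove_of_castSucc_lt _ _ (by simpa [Fin.lt_def] using h)]
    rfl
  rw [this, insertLast, insertPerm_apply_succAbove]

lemma insertLast_apply_of_ge {n : ℕ} (σ : Equiv.Perm (Fin n)) {x : Fin (n + 1)} {y : ℕ}
    (h : (x : ℕ) ≤ y) (hy : y < n) :
    insertLast σ x ⟨y + 1, by lia⟩ = (σ ⟨y, hy⟩).castSucc := by
  have : (⟨y + 1, by lia⟩ : Fin (n + 1)) = x.succAbove ⟨y, hy⟩ := by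
    rw [Fin.succAbove_of_le_castSucc _ _ (by simpa [Fin.le_def] using h)]
    rfl
  rw [this, insertLast, insertPerm_apply_succAbove]

lemma insertLast_apply_self {n : ℕ} (σ : Equiv.Perm (Fin n)) (x : Fin (n + 1)) :
    insertLast σ x x = Fin.last n := by
  simp [insertLast]

/-- Descents beyond the insertion move right by one. A descent across the gap `x` is destroyed, and
the new letter starts one at `x + 1` unless it is last. -/
lemma descentTops_insertLast {n : ℕ} (σ : Equiv.Perm (Fin n)) (x : Fin (n + 1)) :
    descentTops (insertLast σ x)
      = ((descentTops σ).filter fun y => y < (x : ℕ)) ∪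
        (((descentTops σ).filter fun y => (x : ℕ) < y).image (· + 1) ∪
        if (x : ℕ) = n then ∅ else {(x : ℕ) + 1}) := by
  ext y
  cases y with
  | zero =>
    simp only [zero_notMem_descentTops, Finset.mem_union, Finset.mem_filter, Finset.mem_image]
    split_ifs <;> simp
  | succ y =>
    have himg : y + 1 ∈ ((descentTops σ).filter fun y => (x : ℕ) < y).image (· + 1)
        ↔ y ∈ descentTops σ ∧ (x : ℕ) < y := by
      simp
    have hif : (y + 1 ∈ if (x : ℕ) = n then (∅ : Finset ℕ) else {(x : ℕ) + 1})
        ↔ y = x ∧ y < n := by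
      have := x.isLt
      split_ifs <;> simp <;> lia
    rw [Finset.mem_union, Finset.mem_union, himg, hif, Finset.mem_filter]
    rcases lt_trichotomy (y + 1) x with h | h | h
    · have h1 : ¬ (x : ℕ) < y := by lia
      have h2 : ¬ y = x := by lia
      have hn : y + 1 < n := by lia
      simp only [h, h1, h2, and_true, and_false, false_and, or_false, succ_mem_descentTops]
      constructor
      · rintro ⟨h3, h4⟩
        rw [insertLast_apply_of_lt σ h, insertLast_apply_of_lt σ (Nat.lt_of_succ_lt h)] at h4
        exact ⟨hn, h4⟩
      · rintro ⟨h3, h4⟩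
        refine ⟨by lia, ?_⟩
        rw [insertLast_apply_of_lt σ h, insertLast_apply_of_lt σ (Nat.lt_of_succ_lt h)]
        exact h4
    · have h1 : ¬ (x : ℕ) < y := by lia
      have h2 : ¬ y = x := by lia
      simp only [h1, h2, h, lt_irrefl, and_false, false_and, or_false, iff_false]
      rw [← h, succ_mem_descentTops]
      rintro ⟨h3, h4⟩
      have : (⟨y + 1, h3⟩ : Fin (n + 1)) = x := Fin.ext h
      rw [this, insertLast_apply_self] at h4
      exact absurd h4 (not_lt.2 (Fin.le_last _))
    · have h0 : ¬ y + 1 < x := by lia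
      simp only [h0, and_false, false_or]
      rcases Nat.eq_or_lt_of_le (Nat.le_of_lt_succ h) with h1 | h1
      · subst h1
        simp only [lt_irrefl, and_false, true_and, false_or, succ_mem_descentTops]
        constructor
        · rintro ⟨h3, -⟩
          lia
        · intro h3
          refine ⟨by lia, ?_⟩
          rw [insertLast_apply_of_ge σ le_rfl h3]
          exact (Fin.castSucc_lt_last _).trans_eq (insertLast_apply_self σ x).symm
      · have h2 : ¬ y = x := by lia
        simp only [h1, h2, and_true, false_and, or_false]
        obtain ⟨z, rfl⟩ : ∃ z, y = z + 1 := ⟨y - 1, by lia⟩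
        rw [succ_mem_descentTops, succ_mem_descentTops]
        constructor
        · rintro ⟨h3, h4⟩
          rw [insertLast_apply_of_ge σ h1.le (by lia),
            insertLast_apply_of_ge σ (Nat.le_of_lt_succ h1) (by lia)] at h4
          exact ⟨by lia, h4⟩
        · rintro ⟨h3, h4⟩
          refine ⟨by lia, ?_⟩
          rw [insertLast_apply_of_ge σ h1.le (by lia),
            insertLast_apply_of_ge σ (Nat.le_of_lt_succ h1) (by lia)]
          exact h4

lemma sum_descentTops_insertLast {n : ℕ} (σ : Equiv.Perm (Fin n)) (x : Fin (n + 1)) (g : ℕ → ℕ) :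
    ∑ y ∈ descentTops (insertLast σ x), g y
      = ∑ y ∈ (descentTops σ).filter (fun y => y < (x : ℕ)), g y
        + (∑ y ∈ (descentTops σ).filter (fun y => (x : ℕ) < y), g (y + 1)
        + if (x : ℕ) = n then 0 else g (x + 1)) := by
  rw [descentTops_insertLast, Finset.sum_union, Finset.sum_union, Finset.sum_image]
  · split_ifs <;> simp
  · intro a _ b _ h
    exact Nat.succ_injective h
  · rw [Finset.disjoint_left]
    intro y h
    simp only [Finset.mem_image, Finset.mem_filter] at h
    split_ifs
    · simp
    · simp only [Finset.mem_singleton]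
      lia
  · rw [Finset.disjoint_left]
    intro y h
    simp only [Finset.mem_filter] at h
    simp only [Finset.mem_union, Finset.mem_image, Finset.mem_filter]
    split_ifs
    · simp
      lia
    · simp only [Finset.mem_singleton]
      lia

lemma sum_filter_lt_add_filter_le (D : Finset ℕ) (x : ℕ) (g : ℕ → ℕ) :
    ∑ y ∈ D.filter (fun y => y < x), g y + ∑ y ∈ D.filter (fun y => x ≤ y), g y
      = ∑ y ∈ D, g y := by
  rw [← Finset.sum_filter_add_sum_filter_not D (fun y => y < x)]
  simp only [not_lt]

lemma sum_filter_le_eq (D : Finset ℕ) (x : ℕ) (g : ℕ → ℕ) :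
    ∑ y ∈ D.filter (fun y => x ≤ y), g y
      = ∑ y ∈ D.filter (fun y => x < y), g y + if x ∈ D then g x else 0 := by
  simp only [Finset.sum_filter]
  rw [← Finset.sum_ite_eq D x g, ← Finset.sum_add_distrib]
  refine Finset.sum_congr rfl fun y _ => ?_
  rcases lt_trichotomy x y with h | rfl | h
  · simp [h, h.le, h.ne]
  · simp
  · simp [h.not_gt, h.not_ge, h.ne']

lemma des_insertLast {n : ℕ} (σ : Equiv.Perm (Fin n)) (x : Fin (n + 1)) :
    des (insertLast σ x)
      = des σ + if (x : ℕ) ∈ descentTops σ ∨ (x : ℕ) = n then 0 else 1 := by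
  rw [← card_descentTops, ← card_descentTops, Finset.card_eq_sum_ones, Finset.card_eq_sum_ones,
    sum_descentTops_insertLast, ← sum_filter_lt_add_filter_le (descentTops σ) x,
    sum_filter_le_eq]
  have : (x : ℕ) = n → (x : ℕ) ∉ descentTops σ := fun h h' => by
    have := Finset.mem_range.1 (descentTops_subset σ h')
    lia
  split_ifs <;> lia

lemma maj_insertLast {n : ℕ} (σ : Equiv.Perm (Fin n)) (x : Fin (n + 1)) :
    maj (insertLast σ x) = maj σ + increment (descentTops σ) n x := by
  rw [← sum_descentTops, ← sum_descentTops, increment, Finset.card_eq_sum_ones,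
    sum_descentTops_insertLast, ← sum_filter_lt_add_filter_le (descentTops σ) x,
    sum_filter_le_eq, sum_filter_le_eq, Finset.sum_add_distrib]
  have : (x : ℕ) = n → (x : ℕ) ∉ descentTops σ := fun h h' => by
    have := Finset.mem_range.1 (descentTops_subset σ h')
    lia
  split_ifs <;> lia

/-! ### Denert's statistic through excedances and inversions. -/

/-- There are as many letters as positions below `t`; removing the indices with both below `t`
leaves equally many crossings each way. -/
lemma sum_ite_crossing {n : ℕ} (σ : Equiv.Perm (Fin n)) (t : ℕ) :
    (∑ i, if (σ i : ℕ) < t ∧ t ≤ (i : ℕ) then 1 else 0)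
      = ∑ i : Fin n, if (i : ℕ) < t ∧ t ≤ (σ i : ℕ) then 1 else 0 := by
  have h := Equiv.sum_comp σ fun i : Fin n => if (i : ℕ) < t then 1 else 0
  have h1 : (∑ i, if (σ i : ℕ) < t then 1 else 0)
      = (∑ i, if (σ i : ℕ) < t ∧ t ≤ (i : ℕ) then 1 else 0)
        + ∑ i : Fin n, if (σ i : ℕ) < t ∧ (i : ℕ) < t then 1 else 0 := by
    rw [← Finset.sum_add_distrib]
    refine Finset.sum_congr rfl fun i _ => ?_
    split_ifs <;> lia
  have h2 : (∑ i : Fin n, if (i : ℕ) < t then 1 else 0)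
      = (∑ i : Fin n, if (i : ℕ) < t ∧ t ≤ (σ i : ℕ) then 1 else 0)
        + ∑ i : Fin n, if (σ i : ℕ) < t ∧ (i : ℕ) < t then 1 else 0 := by
    rw [← Finset.sum_add_distrib]
    refine Finset.sum_congr rfl fun i _ => ?_
    split_ifs <;> lia
  lia

/-- For each excedance `j`, reverse the crossings at thresholds `j + 1` and `σ j`. Both then contain
the arcs with `i ≤ j` and `σ j ≤ σ i`; the remaining sums count nested pairs of arcs on one side and
crossing pairs on neither: each is the set of interleaved arcs, up to exchanging `i` and `j`. -/
lemma sum_ite_exc_crossing {n : ℕ} (σ : Equiv.Perm (Fin n)) :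
    (∑ j, ∑ i, if σ i ≤ j ∧ j < i ∧ j < σ j then 1 else 0)
      = ∑ j, ∑ i, if σ i < σ j ∧ σ j ≤ i ∧ j < σ j then 1 else 0 := by
  have hX : (∑ j, ∑ i, if σ i ≤ j ∧ j < i ∧ j < σ j then 1 else 0)
      = (∑ j, ∑ i, if i ≤ j ∧ j < σ j ∧ σ j ≤ σ i then 1 else 0)
        + ∑ j, ∑ i, if i ≤ j ∧ j < σ i ∧ σ i < σ j then 1 else 0 := by
    rw [← Finset.sum_add_distrib]
    refine Finset.sum_congr rfl fun j _ => ?_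
    rw [← Finset.sum_add_distrib]
    by_cases hj : j < σ j
    · have := sum_ite_crossing σ (j + 1)
      trans ∑ i, if (σ i : ℕ) < j + 1 ∧ (j : ℕ) + 1 ≤ i then 1 else 0
      · refine Finset.sum_congr rfl fun i _ => ?_
        split_ifs <;> lia
      · rw [this]
        refine Finset.sum_congr rfl fun i _ => ?_
        split_ifs <;> lia
    · refine Finset.sum_congr rfl fun i _ => ?_
      split_ifs <;> lia
  have hY : (∑ j, ∑ i, if σ i < σ j ∧ σ j ≤ i ∧ j < σ j then 1 else 0)
      = (∑ j, ∑ i, if i ≤ j ∧ j < σ j ∧ σ j ≤ σ i then 1 else 0)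
        + ∑ j, ∑ i, if j ≤ i ∧ i < σ j ∧ σ j < σ i then 1 else 0 := by
    rw [← Finset.sum_add_distrib]
    refine Finset.sum_congr rfl fun j _ => ?_
    rw [← Finset.sum_add_distrib]
    by_cases hj : j < σ j
    · have := sum_ite_crossing σ (σ j)
      trans ∑ i, if (σ i : ℕ) < σ j ∧ (σ j : ℕ) ≤ i then 1 else 0
      · refine Finset.sum_congr rfl fun i _ => ?_
        split_ifs <;> lia
      · rw [this]
        refine Finset.sum_congr rfl fun i _ => ?_
        have hij : σ i = σ j ↔ i = j := σ.injective.eq_iff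
        split_ifs <;> lia
    · refine Finset.sum_congr rfl fun i _ => ?_
      split_ifs <;> lia
  rw [hX, hY, Finset.sum_comm (f := fun j i => if i ≤ j ∧ j < σ i ∧ σ i < σ j then 1 else 0)]

/-- Denert's statistic is the sum of the excedance positions, plus the number of inversions
among the excedances, plus the number of inversions among the other letters. -/
lemma den_eq_sum_exc_add_inv {n : ℕ} (σ : Equiv.Perm (Fin n)) :
    den σ = (∑ j, if j < σ j then (j : ℕ) + 1 else 0)
      + (∑ i, ∑ j, if i < j ∧ σ j < σ i ∧ j < σ j then 1 else 0)
      + ∑ i, ∑ j, if i < j ∧ σ i ≤ i ∧ σ j < σ i then 1 else 0 := by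
  have h1 : (∑ j, if j < σ j then (j : ℕ) + 1 else 0)
      = (∑ j, ∑ i, if i < j ∧ σ i ≤ j ∧ j < σ j then 1 else 0)
        + ∑ j, ∑ i, if σ i ≤ j ∧ j < i ∧ j < σ j then 1 else 0 := by
    rw [← Finset.sum_add_distrib]
    refine Finset.sum_congr rfl fun j _ => ?_
    rw [← Finset.sum_add_distrib]
    by_cases hj : j < σ j
    · have h : (∑ i, if σ i ≤ j then 1 else 0) = (j : ℕ) + 1 := by
        rw [Equiv.sum_comp σ fun i : Fin n => if i ≤ j then 1 else 0, ← Finset.card_filter,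
          Finset.filter_ge_eq_Iic, Fin.card_Iic]
      rw [if_pos hj, ← h]
      refine Finset.sum_congr rfl fun i _ => ?_
      have : i = j → σ i = σ j := fun h => h ▸ rfl
      split_ifs <;> lia
    · simp [hj]
  -- If `i` is not an excedance, `σ i ≤ j` follows from `i < j`; if it is, `i < j` follows from `σ i
  -- ≤ j`.
  have h3 : (∑ i, ∑ j, if i < j ∧ σ i ≤ j ∧ σ j < σ i then 1 else 0)
      = (∑ i, ∑ j, if i < j ∧ σ i ≤ i ∧ σ j < σ i then 1 else 0)
        + ∑ i, ∑ j, if σ j < σ i ∧ σ i ≤ j ∧ i < σ i then 1 else 0 := by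
    rw [← Finset.sum_add_distrib]
    refine Finset.sum_congr rfl fun i _ => ?_
    rw [← Finset.sum_add_distrib]
    refine Finset.sum_congr rfl fun j _ => ?_
    split_ifs <;> lia
  simp only [den, Finset.card_filter, Fintype.sum_prod_type, gt_iff_lt, ge_iff_le]
  rw [h1, h3, sum_ite_exc_crossing,
    Finset.sum_comm (f := fun i j => if i < j ∧ σ i ≤ j ∧ j < σ j then 1 else 0)]
  lia

/-! ### Excedance letters and their upward shift. -/

/-- The values of a permutation at its excedances. -/
def excLetters {n : ℕ} (σ : Equiv.Perm (Fin n)) : Finset ℕ :=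
  (Finset.univ.filter fun i : Fin n => i < σ i).image fun i => (σ i : ℕ)

lemma apply_mem_excLetters {n : ℕ} {σ : Equiv.Perm (Fin n)} {i : Fin n} :
    (σ i : ℕ) ∈ excLetters σ ↔ i < σ i := by
  simp only [excLetters, Finset.mem_image, Finset.mem_filter, Finset.mem_univ, true_and]
  constructor
  · rintro ⟨j, hj, h⟩
    rwa [σ.injective (Fin.ext h)] at hj
  · exact fun h => ⟨i, h, rfl⟩

lemma excLetters_subset {n : ℕ} (σ : Equiv.Perm (Fin n)) : excLetters σ ⊆ Finset.range n := by
  intro y hy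
  simp only [excLetters, Finset.mem_image] at hy
  obtain ⟨i, -, rfl⟩ := hy
  exact Finset.mem_range.2 (σ i).isLt

lemma card_filter_excLetters {n : ℕ} (σ : Equiv.Perm (Fin n)) (p : ℕ → Prop) [DecidablePred p] :
    ((excLetters σ).filter p).card = ∑ i, if i < σ i ∧ p (σ i) then 1 else 0 := by
  have hinj : Function.Injective fun i => (σ i : ℕ) := Fin.val_injective.comp σ.injective
  rw [excLetters, Finset.filter_image, Finset.card_image_of_injective _ hinj,
    Finset.filter_filter, Finset.card_filter]

lemma card_excLetters {n : ℕ} (σ : Equiv.Perm (Fin n)) : (excLetters σ).card = exc σ :=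
  Finset.card_image_of_injective _ (Fin.val_injective.comp σ.injective)

/-- The least element of `D ∪ {n}` that is at least `t`. -/
noncomputable def nextLetter (D : Finset ℕ) (n t : ℕ) : ℕ := sInf {z | t ≤ z ∧ (z ∈ D ∨ z = n)}

lemma nextLetter_spec (D : Finset ℕ) {n t : ℕ} (ht : t ≤ n) :
    t ≤ nextLetter D n t ∧ (nextLetter D n t ∈ D ∨ nextLetter D n t = n) :=
  Nat.sInf_mem (s := {z | t ≤ z ∧ (z ∈ D ∨ z = n)}) ⟨n, ht, Or.inr rfl⟩

lemma nextLetter_le {D : Finset ℕ} {n t z : ℕ} (h : t ≤ z) (hz : z ∈ D ∨ z = n) :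
    nextLetter D n t ≤ z :=
  Nat.sInf_le (s := {z | t ≤ z ∧ (z ∈ D ∨ z = n)}) ⟨h, hz⟩

lemma nextLetter_le_iff {D : Finset ℕ} {n t : ℕ} (ht : t ≤ n) :
    nextLetter D n t ≤ t ↔ t ∈ D ∨ t = n := by
  refine ⟨fun h => ?_, nextLetter_le le_rfl⟩
  have := nextLetter_spec D ht
  rw [le_antisymm h this.1] at this
  exact this.2

/-- The letters of `D` from `x` on are each replaced by the next element of `D ∪ {n}`. -/
noncomputable def shiftLetter (D : Finset ℕ) (n x v : ℕ) : ℕ :=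
  if v ∈ D ∧ x ≤ v then nextLetter D n (v + 1) else v

section shiftLetter

variable {D : Finset ℕ} {n x u v : ℕ}

lemma shiftLetter_of_notMem (h : v ∉ D) : shiftLetter D n x v = v := by
  simp [shiftLetter, h]

lemma shiftLetter_of_lt (h : v < x) : shiftLetter D n x v = v := by
  simp [shiftLetter, h]

lemma lt_shiftLetter (hv : v < n) (h : v ∈ D) (hx : x ≤ v) : v < shiftLetter D n x v := by
  rw [shiftLetter, if_pos ⟨h, hx⟩]
  exact (nextLetter_spec D (Nat.succ_le_of_lt hv)).1

lemma le_shiftLetter (hv : v < n) : v ≤ shiftLetter D n x v := by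
  by_cases h : v ∈ D ∧ x ≤ v
  · exact (lt_shiftLetter hv h.1 h.2).le
  · rw [shiftLetter, if_neg h]

lemma shiftLetter_le (hv : v < n) : shiftLetter D n x v ≤ n := by
  unfold shiftLetter
  split_ifs
  · exact nextLetter_le hv (Or.inr rfl)
  · exact hv.le

lemma shiftLetter_mem_iff (hv : v < n) :
    (shiftLetter D n x v ∈ D ∨ shiftLetter D n x v = n) ↔ v ∈ D := by
  by_cases h : v ∈ D
  · simp only [h, iff_true, shiftLetter, true_and]
    split_ifs
    · exact (nextLetter_spec D (Nat.succ_le_of_lt hv)).2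
    · exact Or.inl h
  · rw [shiftLetter_of_notMem h]
    simp [h, hv.ne]

lemma shiftLetter_lt_shiftLetter (hv : v < n) (hvD : v ∈ D) (h : u < v) :
    shiftLetter D n x u < shiftLetter D n x v := by
  have h1 : v ≤ shiftLetter D n x v := le_shiftLetter hv
  by_cases hu : u ∈ D ∧ x ≤ u
  · have h2 : shiftLetter D n x u ≤ v := by
      rw [shiftLetter, if_pos hu]
      exact nextLetter_le h (Or.inl hvD)
    exact h2.trans_lt (lt_shiftLetter hv hvD (by lia))
  · rw [shiftLetter, if_neg hu]
    lia

lemma shiftLetter_lt_iff (hv : v < n) (hvD : v ∈ D) (hu : u < n) (huD : u ∈ D) :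
    shiftLetter D n x u < shiftLetter D n x v ↔ u < v := by
  refine ⟨fun h => ?_, shiftLetter_lt_shiftLetter hv hvD⟩
  by_contra! h'
  rcases h'.eq_or_lt with rfl | h'
  · exact lt_irrefl _ h
  · exact lt_asymm h (shiftLetter_lt_shiftLetter hu huD h')

lemma nextLetter_lt_shiftLetter (hv : v < n) (hvD : v ∈ D) (h : x ≤ v) :
    nextLetter D n x < shiftLetter D n x v :=
  (nextLetter_le h (Or.inl hvD)).trans_lt (lt_shiftLetter hv hvD h)

lemma shiftLetter_lt_nextLetter (hx : x ≤ n) (h : v < x) :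
    shiftLetter D n x v < nextLetter D n x := by
  rw [shiftLetter_of_lt h]
  exact h.trans_le (nextLetter_spec D hx).1

lemma shiftLetter_ne_nextLetter (hx : x ≤ n) (hv : v < n) :
    shiftLetter D n x v ≠ nextLetter D n x := by
  by_cases hvD : v ∈ D
  · rcases lt_or_ge v x with h | h
    · exact (shiftLetter_lt_nextLetter hx h).ne
    · exact (nextLetter_lt_shiftLetter hv hvD h).ne'
  · intro h
    exact hvD ((shiftLetter_mem_iff hv).1 (h ▸ (nextLetter_spec D hx).2))

/-- Whether the image lies in `D ∪ {n}` reveals whether the letter was in `D`; the shift is strictly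
increasing on `D` and the identity elsewhere. -/
lemma shiftLetter_injOn (hv : v < n) (hu : u < n)
    (h : shiftLetter D n x u = shiftLetter D n x v) : u = v := by
  have h1 := shiftLetter_mem_iff (D := D) (x := x) hv
  have h2 := shiftLetter_mem_iff (D := D) (x := x) hu
  rw [h] at h2
  by_cases hvD : v ∈ D
  · have huD := h2.1 (h1.2 hvD)
    rcases lt_trichotomy u v with h' | h' | h'
    · exact absurd h (shiftLetter_lt_shiftLetter hv hvD h').ne
    · exact h'
    · exact absurd h (shiftLetter_lt_shiftLetter hu huD h').ne'
  · rwa [shiftLetter_of_notMem hvD, shiftLetter_of_notMem fun huD => hvD (h1.1 (h2.2 huD))] at h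

end shiftLetter

/-! ### Inserting a letter: excedances and Denert's statistic. -/

/-- The insertion adapted to the excedances: the excedance letters from `x` on are shifted up
cyclically within the set that they form with the new largest letter, and the letter so released
is inserted at the position `x`. -/
noncomputable def insertExc {n : ℕ} (σ : Equiv.Perm (Fin n)) (x : Fin (n + 1)) :
    Equiv.Perm (Fin (n + 1)) :=
  insertPerm x
    ⟨nextLetter (excLetters σ) n x,
      Nat.lt_succ_of_le (nextLetter_le (Nat.le_of_lt_succ x.isLt) (Or.inr rfl))⟩
    (fun i => ⟨shiftLetter (excLetters σ) n x (σ i), Nat.lt_succ_of_le (shiftLetter_le (σ i).isLt)⟩)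
    (fun i j h => σ.injective (Fin.ext
      (shiftLetter_injOn (σ j).isLt (σ i).isLt (congrArg Fin.val h))))
    (fun i h => shiftLetter_ne_nextLetter (Nat.le_of_lt_succ x.isLt) (σ i).isLt
      (congrArg Fin.val h))

section insertExc

variable {n : ℕ} (σ : Equiv.Perm (Fin n)) (x : Fin (n + 1))

lemma insertExc_apply_self : (insertExc σ x x : ℕ) = nextLetter (excLetters σ) n x :=
  congrArg Fin.val (insertPerm_apply_same _ _ _ _ _)

lemma insertExc_apply_succAbove (i : Fin n) :
    (insertExc σ x (x.succAbove i) : ℕ) = shiftLetter (excLetters σ) n x (σ i) :=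
  congrArg Fin.val (insertPerm_apply_succAbove _ _ _ _ _ _)

lemma val_succAbove_eq (i : Fin n) :
    (x.succAbove i : ℕ) = i + if (x : ℕ) ≤ i then 1 else 0 := by
  by_cases h : (x : ℕ) ≤ i
  · rw [Fin.succAbove_of_le_castSucc _ _ (by simpa [Fin.le_def] using h), if_pos h]
    rfl
  · rw [Fin.succAbove_of_castSucc_lt _ _ (by simpa [Fin.lt_def] using h), if_neg h]
    rfl

lemma shiftLetter_of_le {i : Fin n} (h : σ i ≤ i) :
    shiftLetter (excLetters σ) n x (σ i) = σ i :=
  shiftLetter_of_notMem fun h' => absurd (apply_mem_excLetters.1 h') (not_lt.2 h)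

/-- An excedance whose position moves has a letter above `x`, which is also raised; the letter of a
non-excedance never changes. -/
lemma exc_insertExc_iff (i : Fin n) :
    x.succAbove i < insertExc σ x (x.succAbove i) ↔ i < σ i := by
  rw [Fin.lt_def, insertExc_apply_succAbove, val_succAbove_eq]
  constructor
  · intro h
    by_contra! h'
    rw [shiftLetter_of_le σ x h'] at h
    have : (σ i : ℕ) ≤ i := h'
    lia
  · intro h
    have h1 : (σ i : ℕ) ≤ shiftLetter (excLetters σ) n x (σ i) := le_shiftLetter (σ i).isLt
    have h2 : (i : ℕ) < σ i := h
    split_ifs with hx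
    · have := lt_shiftLetter (x := x) (σ i).isLt (apply_mem_excLetters.2 h) (by lia)
      lia
    · lia

lemma exc_insertExc_self_iff :
    x < insertExc σ x x ↔ ¬ ((x : ℕ) ∈ excLetters σ ∨ (x : ℕ) = n) := by
  rw [Fin.lt_def, insertExc_apply_self, ← nextLetter_le_iff (Nat.le_of_lt_succ x.isLt), not_le]

lemma exc_insertExc :
    exc (insertExc σ x)
      = exc σ + if (x : ℕ) ∈ excLetters σ ∨ (x : ℕ) = n then 0 else 1 := by
  simp only [exc, Finset.card_filter]
  rw [Fin.sum_univ_succAbove _ x, add_comm]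
  simp only [exc_insertExc_iff, exc_insertExc_self_iff, ite_not]

lemma excInv_insertExc_iff (i j : Fin n) :
    (x.succAbove i < x.succAbove j ∧
      insertExc σ x (x.succAbove j) < insertExc σ x (x.succAbove i) ∧
      x.succAbove j < insertExc σ x (x.succAbove j)) ↔ i < j ∧ σ j < σ i ∧ j < σ j := by
  rw [exc_insertExc_iff, Fin.succAbove_lt_succAbove_iff]
  refine and_congr_right fun hij => and_congr_left fun hj => ?_
  rw [Fin.lt_def, Fin.lt_def, insertExc_apply_succAbove, insertExc_apply_succAbove]
  have hjD := apply_mem_excLetters.2 hj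
  by_cases hi : i < σ i
  · exact shiftLetter_lt_iff (σ i).isLt (apply_mem_excLetters.2 hi) (σ j).isLt hjD
  · rw [shiftLetter_of_le σ x (not_lt.1 hi)]
    have : (σ j : ℕ) ≤ shiftLetter (excLetters σ) n x (σ j) := le_shiftLetter (σ j).isLt
    lia

lemma nexcInv_insertExc_iff (i j : Fin n) :
    (x.succAbove i < x.succAbove j ∧
      insertExc σ x (x.succAbove i) ≤ x.succAbove i ∧
      insertExc σ x (x.succAbove j) < insertExc σ x (x.succAbove i))
      ↔ i < j ∧ σ i ≤ i ∧ σ j < σ i := by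
  rw [← not_lt (a := x.succAbove i), exc_insertExc_iff, Fin.succAbove_lt_succAbove_iff, not_lt]
  refine and_congr_right fun hij => and_congr_right fun hi => ?_
  rw [Fin.lt_def, Fin.lt_def, insertExc_apply_succAbove, insertExc_apply_succAbove,
    shiftLetter_of_le σ x hi]
  by_cases hj : j < σ j
  · have : (σ j : ℕ) ≤ shiftLetter (excLetters σ) n x (σ j) := le_shiftLetter (σ j).isLt
    lia
  · rw [shiftLetter_of_le σ x (not_lt.1 hj)]

/-- Exactly the excedance letters that were at least `x` end up above the inserted letter. -/
lemma excInv_insertExc_left_iff (i : Fin n) :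
    (x.succAbove i < x ∧ insertExc σ x x < insertExc σ x (x.succAbove i) ∧
      x < insertExc σ x x)
      ↔ ¬ ((x : ℕ) ∈ excLetters σ ∨ (x : ℕ) = n) ∧ (i : ℕ) < x ∧ (x : ℕ) ≤ σ i := by
  rw [exc_insertExc_self_iff, and_comm, and_assoc, and_comm, and_assoc]
  refine and_congr_right fun hx => ?_
  have hle := Nat.le_of_lt_succ x.isLt
  rw [Fin.lt_def, Fin.lt_def, val_succAbove_eq, insertExc_apply_self, insertExc_apply_succAbove]
  have h1 : ((i : ℕ) + if (x : ℕ) ≤ i then 1 else 0) < x ↔ (i : ℕ) < x := by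
    split_ifs <;> lia
  rw [h1]
  refine and_congr_right fun hi => ?_
  constructor
  · intro h
    by_contra! h'
    exact lt_asymm h (shiftLetter_lt_nextLetter hle h')
  · intro h
    exact nextLetter_lt_shiftLetter (σ i).isLt (apply_mem_excLetters.2 (by lia)) h

lemma not_excInv_insertExc_right (j : Fin n) :
    ¬ (x < x.succAbove j ∧ insertExc σ x (x.succAbove j) < insertExc σ x x ∧
      x.succAbove j < insertExc σ x (x.succAbove j)) := by
  rw [exc_insertExc_iff]
  rintro ⟨h1, h2, h3⟩
  rw [Fin.lt_def, val_succAbove_eq] at h1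
  rw [Fin.lt_def, insertExc_apply_self, insertExc_apply_succAbove] at h2
  have h4 : (x : ℕ) ≤ j := by
    split_ifs at h1 <;> lia
  have := nextLetter_lt_shiftLetter (x := x) (σ j).isLt (apply_mem_excLetters.2 h3) (by lia)
  lia

lemma not_nexcInv_insertExc_left (i : Fin n) :
    ¬ (x.succAbove i < x ∧ insertExc σ x (x.succAbove i) ≤ x.succAbove i ∧
      insertExc σ x x < insertExc σ x (x.succAbove i)) := by
  rintro ⟨h1, h2, h3⟩
  have h4 := (nextLetter_spec (excLetters σ) (Nat.le_of_lt_succ x.isLt)).1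
  rw [← insertExc_apply_self] at h4
  lia

lemma nexcInv_insertExc_right_iff (j : Fin n) :
    (x < x.succAbove j ∧ insertExc σ x x ≤ x ∧
      insertExc σ x (x.succAbove j) < insertExc σ x x)
      ↔ ((x : ℕ) ∈ excLetters σ ∨ (x : ℕ) = n) ∧ (σ j : ℕ) < x ∧ (x : ℕ) ≤ j := by
  rw [← not_lt (a := x), exc_insertExc_self_iff, not_not, and_left_comm]
  refine and_congr_right fun hx => ?_
  have hle := Nat.le_of_lt_succ x.isLt
  rw [Fin.lt_def, Fin.lt_def, val_succAbove_eq, insertExc_apply_self, insertExc_apply_succAbove,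
    and_comm]
  have h1 : (x : ℕ) < ((j : ℕ) + if (x : ℕ) ≤ j then 1 else 0) ↔ (x : ℕ) ≤ j := by
    split_ifs <;> lia
  rw [h1]
  refine and_congr_left fun hj => ?_
  refine ⟨fun h => ?_, shiftLetter_lt_nextLetter hle⟩
  exact (le_shiftLetter (σ j).isLt).trans_lt (h.trans_le ((nextLetter_le_iff hle).2 hx))

lemma den_insertExc :
    den (insertExc σ x) = den σ + increment (excLetters σ) n x := by
  have hS : (∑ i : Fin n, if i < σ i then (x.succAbove i : ℕ) + 1 else 0)
      = (∑ i : Fin n, if i < σ i then (i : ℕ) + 1 else 0)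
        + ∑ i : Fin n, if i < σ i ∧ (x : ℕ) ≤ i then 1 else 0 := by
    rw [← Finset.sum_add_distrib]
    refine Finset.sum_congr rfl fun i _ => ?_
    rw [val_succAbove_eq]
    split_ifs <;> lia
  -- Excedances at positions from `x` on advance by one; those before `x` with letter at least `x`
  -- become inversions with a new excedance.
  have hE : ((excLetters σ).filter fun y => (x : ℕ) ≤ y).card
      = (∑ i : Fin n, if i < σ i ∧ (x : ℕ) ≤ i then 1 else 0)
        + ∑ i : Fin n, if (i : ℕ) < x ∧ (x : ℕ) ≤ σ i then 1 else 0 := by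
    rw [card_filter_excLetters, ← Finset.sum_add_distrib]
    refine Finset.sum_congr rfl fun i _ => ?_
    split_ifs <;> lia
  -- An inserted non-excedance creates inversions counted by the opposite crossing at `x`; this
  -- equates the two counts.
  have hcross := sum_ite_crossing σ x
  rw [den_eq_sum_exc_add_inv, den_eq_sum_exc_add_inv, increment, hE, Fin.sum_univ_succAbove _ x,
    Fin.sum_univ_succAbove (fun i => ∑ j, _) x, Fin.sum_univ_succAbove (fun i => ∑ j, _) x]
  simp only [Fin.sum_univ_succAbove _ x, excInv_insertExc_iff, nexcInv_insertExc_iff,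
    excInv_insertExc_left_iff, not_excInv_insertExc_right, not_nexcInv_insertExc_left,
    nexcInv_insertExc_right_iff, lt_irrefl, false_and, if_false, zero_add, Finset.sum_const_zero,
    Finset.sum_add_distrib]
  simp only [exc_insertExc_iff, exc_insertExc_self_iff, hS]
  by_cases hx : (x : ℕ) ∈ excLetters σ ∨ (x : ℕ) = n
  · simp only [hx, not_true_eq_false, if_false, if_true, false_and, true_and,
      Finset.sum_const_zero]
    lia
  · simp only [hx, not_false_eq_true, if_false, if_true, false_and, true_and,
      Finset.sum_const_zero]
    lia

/-- Together with `insertExc_not_isolated`, this recovers `x` as the last weak excedance `j` with no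
excedance letter in the interval from `j` up to, but excluding, its own letter. -/
lemma insertExc_self_isolated :
    x ≤ insertExc σ x x ∧ ∀ k, k < insertExc σ x k →
      ¬ (x ≤ insertExc σ x k ∧ insertExc σ x k < insertExc σ x x) := by
  have hle := Nat.le_of_lt_succ x.isLt
  refine ⟨?_, fun k hk => ?_⟩
  · rw [Fin.le_def, insertExc_apply_self]
    exact (nextLetter_spec _ hle).1
  · rcases Fin.eq_self_or_eq_succAbove x k with rfl | ⟨i, rfl⟩
    · simp
    · rw [exc_insertExc_iff] at hk
      rw [Fin.lt_def, Fin.le_def, insertExc_apply_self, insertExc_apply_succAbove]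
      rintro ⟨h1, h2⟩
      rcases lt_or_ge (σ i : ℕ) x with h | h
      · rw [shiftLetter_of_lt h] at h1
        lia
      · exact lt_asymm h2
          (nextLetter_lt_shiftLetter (σ i).isLt (apply_mem_excLetters.2 hk) h)

lemma insertExc_not_isolated {j : Fin (n + 1)} (hj : x < j) (hle : j ≤ insertExc σ x j) :
    ∃ k, k < insertExc σ x k ∧ j ≤ insertExc σ x k ∧ insertExc σ x k < insertExc σ x j := by
  rcases Fin.eq_self_or_eq_succAbove x j with rfl | ⟨i, rfl⟩
  · exact absurd hj (lt_irrefl _)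
  have hxi : (x : ℕ) ≤ i := by
    rw [Fin.lt_def, val_succAbove_eq] at hj
    split_ifs at hj <;> lia
  have hval : (x.succAbove i : ℕ) = i + 1 := by
    rw [val_succAbove_eq, if_pos hxi]
  have hi : i < σ i := by
    by_contra! h
    rw [Fin.le_def, insertExc_apply_succAbove, shiftLetter_of_le σ x h, hval] at hle
    lia
  -- The old letter `σ i` is the obstruction: it was shifted away from its place and is now carried
  -- by another excedance.
  obtain ⟨k, hk⟩ := (insertExc σ x).surjective (σ i).castSucc
  have hk' : (insertExc σ x k : ℕ) = σ i := by
    rw [hk]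
    rfl
  have hmem := apply_mem_excLetters.2 hi
  refine ⟨k, ?_, ?_, ?_⟩
  · rcases Fin.eq_self_or_eq_succAbove x k with rfl | ⟨l, rfl⟩
    · rw [Fin.lt_def, hk']
      lia
    · rw [exc_insertExc_iff, ← apply_mem_excLetters]
      rw [insertExc_apply_succAbove] at hk'
      rw [← shiftLetter_mem_iff (x := x) (σ l).isLt, hk']
      exact Or.inl hmem
  · rw [Fin.le_def, hk', hval]
    exact hi
  · rw [Fin.lt_def, hk', insertExc_apply_succAbove]
    exact lt_shiftLetter (σ i).isLt hmem (by lia)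

end insertExc

/-! ### Injectivity of the insertion and equidistribution. -/

lemma position_le_of_insertExc_eq {n : ℕ} {σ τ : Equiv.Perm (Fin n)} {x y : Fin (n + 1)}
    (h : insertExc σ x = insertExc τ y) : y ≤ x := by
  by_contra! hxy
  have h1 := insertExc_self_isolated τ y
  rw [← h] at h1
  obtain ⟨k, hk, hk'⟩ := insertExc_not_isolated σ x hxy h1.1
  exact h1.2 k hk hk'

lemma insertExc_injective {n : ℕ} :
    Function.Injective fun y : Equiv.Perm (Fin n) × Fin (n + 1) => insertExc y.1 y.2 := by
  rintro ⟨σ, x⟩ ⟨τ, y⟩ h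
  simp only at h
  obtain rfl : x = y :=
    le_antisymm (position_le_of_insertExc_eq h.symm) (position_le_of_insertExc_eq h)
  have hexc (i : Fin n) : i < σ i ↔ i < τ i := by
    rw [← exc_insertExc_iff σ x, h, exc_insertExc_iff]
  have hval (i : Fin n) : shiftLetter (excLetters σ) n x (σ i)
      = shiftLetter (excLetters τ) n x (τ i) := by
    rw [← insertExc_apply_succAbove, h, insertExc_apply_succAbove]
  have hnexc (i : Fin n) (hi : ¬ i < σ i) : σ i = τ i := by
    have := hval i
    rw [shiftLetter_of_le σ x (not_lt.1 hi),
      shiftLetter_of_le τ x (not_lt.1 (mt (hexc i).2 hi))] at this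
    exact Fin.ext this
  -- Non-excedances keep their letters, so the complementary sets of excedance letters agree too;
  -- the shift can then be undone with a common `D`.
  have hmem (v : Fin n) : (v : ℕ) ∈ excLetters σ ↔ (v : ℕ) ∈ excLetters τ := by
    obtain ⟨i, rfl⟩ := σ.surjective v
    obtain ⟨j, hj⟩ := τ.surjective (σ i)
    rw [apply_mem_excLetters]
    by_cases hi : i < σ i
    · simp only [hi, true_iff]
      rw [← hj, apply_mem_excLetters, ← hexc]
      by_contra hj'
      have := hnexc j hj'
      rw [hj] at this
      exact hj' (σ.injective this ▸ hi)
    · rw [hnexc i hi, apply_mem_excLetters, ← hnexc i hi]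
  have hE : excLetters σ = excLetters τ := by
    ext v
    by_cases hv : v < n
    · exact hmem ⟨v, hv⟩
    · exact iff_of_false (fun h' => hv (Finset.mem_range.1 (excLetters_subset σ h')))
        (fun h' => hv (Finset.mem_range.1 (excLetters_subset τ h')))
  refine Prod.ext (Equiv.ext fun i => ?_) rfl
  have := hval i
  rw [hE] at this
  exact Fin.ext (shiftLetter_injOn (τ i).isLt (σ i).isLt this)

lemma exists_equiv_exc_den (n : ℕ) :
    ∃ φ : Equiv.Perm (Fin n) ≃ Equiv.Perm (Fin n),
      ∀ σ, des (φ σ) = exc σ ∧ maj (φ σ) = den σ := by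
  induction n with
  | zero =>
    refine ⟨Equiv.refl _, fun σ => ?_⟩
    simp [des, exc, maj, den, descents]
  | succ n ih =>
    obtain ⟨φ, hφ⟩ := ih
    obtain ⟨Φ, hΦ⟩ := exists_equiv_of_insertion excLetters _ insertExc_injective
      excLetters_subset card_excLetters exc_insertExc den_insertExc
    obtain ⟨Ψ, hΨ⟩ := exists_equiv_of_insertion descentTops _ insertLast_injective
      descentTops_subset card_descentTops des_insertLast maj_insertLast
    -- Remove a letter by one insertion and reinsert by the other, keeping the same increment `s`.
    refine ⟨Φ.symm.trans ((Equiv.prodCongr φ (Equiv.refl _)).trans Ψ), fun σ => ?_⟩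
    obtain ⟨⟨τ, s⟩, rfl⟩ := Φ.surjective σ
    simp [hΦ, hΨ, hφ]

lemma jointlyDistributed_exc_den (n : ℕ) :
    JointlyDistributed (n := n) exc den des maj := by
  obtain ⟨φ, hφ⟩ := exists_equiv_exc_den n
  unfold JointlyDistributed jointGen
  rw [← Equiv.sum_comp φ fun σ => MvPolynomial.X 0 ^ des σ * MvPolynomial.X 1 ^ maj σ]
  simp only [hφ]

end RookStat

theorem mainTheorem5 (n : ℕ) :
    (∀ σ : Equiv.Perm (Fin n),
      (RookStat.xi (RookStat.transpose (RookStat.graph σ))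
          (RookStat.complBoard (RookStat.triBoard n)) : ℤ)
        = (n : ℤ) * (RookStat.exc σ : ℤ) - (RookStat.den σ : ℤ)) ∧
    RookStat.JointlyDistributed (n := n) RookStat.exc RookStat.den RookStat.des RookStat.maj :=
  ⟨fun σ => eq_sub_of_add_eq (RookStat.xi_add_den σ), RookStat.jointlyDistributed_exc_den n⟩
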